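/- Let $F$ be a nonarchimedean local field of characteristic $0$ with valuation ring $\mathfrak g$. Let $V$ be a $4$-dimensional vector space over $F$ with a nondegenerate symmetric $F$-bilinear form $\varphi$, and put $\varphi[x]=\varphi(x,x)$. For a subspace $U$ of $V$ let $A(U)$ denote the Clifford algebra of the restriction of $\varphi$ to $U$, in which $x^2=\varphi[x]$ for $x\in U$, and let $A^+(U)$ denote its even part; $A(U)$ is regarded as a subalgebra of $A(V)$ via the canonical injection induced by the inclusion $U\subset V$. A $\mathfrak g$-lattice in $U$ is a finitely generated $\mathfrak g$-submodule of $U$ containing an $F$-basis of $U$, and it is called integral if $\varphi[x]\in\mathfrak g$ for all its elements $x$. For an integral lattice $N$ in $U$ let $A(N)$ be the subring of $A(U)$ generated by $\mathfrak g$ and $N$, and put $A^+(N)=A^+(U)\cap A(N)$. Let $L$ be a maximal lattice in $V$, that is, a $\mathfrak g$-lattice that is maximal for inclusion among the integral $\mathfrak g$-lattices in $V$. Let $h\in V$ be any element with $\varphi[h]\neq 0$, and put $W=(Fh)^{\perp}=\{x\in V\mid \varphi(x,h)=0\}$. Then $$A^+(L\cap W)=A^+(L)\cap A^+(W).$$ 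-/

import Mathlib

open scoped ValuativeRel

namespace TernaryLattice

section Quadratic

variable {F V : Type*} [Field F] [AddCommGroup V] [Module F V]

/-- The quadratic form `φ[x] = φ(x, x)` of a bilinear form `φ`.  The Clifford algebra of `φ` is
`CliffordAlgebra (quadForm φ)`, in which `x * x = φ[x]` for all `x ∈ V`. -/
def quadForm (φ : LinearMap.BilinForm F V) : QuadraticForm F V :=
  LinearMap.BilinMap.toQuadraticMap φ

/-- The subspace `(F h)^⊥` of all `x` with `φ(h, x) = 0`. -/
def perp (φ : LinearMap.BilinForm F V) (h : V) : Submodule F V :=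
  φ.orthogonal (Submodule.span F {h})

theorem mem_perp {φ : LinearMap.BilinForm F V} {h x : V} : x ∈ perp φ h ↔ φ h x = 0 := by
  refine ⟨fun hx => hx h (Submodule.mem_span_singleton_self h), fun hx n hn => ?_⟩
  obtain ⟨a, rfl⟩ := Submodule.mem_span_singleton.1 hn
  change φ (a • h) x = 0
  simp [hx]

/-- The inclusion of a subspace `W`, equipped with the restriction of `φ`, into `V`. -/
def subspaceIsometry (φ : LinearMap.BilinForm F V) (W : Submodule F V) :
    quadForm (φ.restrict W) →qᵢ quadForm φ where
  toLinearMap := W.subtype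
  map_app' _ := rfl

/-- The canonical algebra homomorphism `A(W) → A(V)`, by which the Clifford algebra of the
restriction of `φ` to `W` is regarded as a subalgebra of the Clifford algebra of `φ`. -/
noncomputable def cliffordIncl (φ : LinearMap.BilinForm F V) (W : Submodule F V) :
    CliffordAlgebra (quadForm (φ.restrict W)) →ₐ[F] CliffordAlgebra (quadForm φ) :=
  CliffordAlgebra.map (subspaceIsometry φ W)

open CliffordAlgebra in
theorem contractLeft_map {V₁ V₂ : Type*} [AddCommGroup V₁] [Module F V₁] [AddCommGroup V₂]
    [Module F V₂] {Q₁ : QuadraticForm F V₁} {Q₂ : QuadraticForm F V₂} (f : Q₁ →qᵢ Q₂)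
    (d : Module.Dual F V₂) (x : CliffordAlgebra Q₁) :
    contractLeft d (map f x) = map f (contractLeft (d ∘ₗ f.toLinearMap) x) := by
  induction x using CliffordAlgebra.left_induction with
  | algebraMap r => simp
  | add x y hx hy => simp only [map_add, hx, hy]
  | ι_mul x m hx =>
    simp only [map_mul, map_apply_ι, contractLeft_ι_mul, map_sub, map_smul, hx]
    rfl

open CliffordAlgebra in
/-- The homomorphism `A(W) → A(V)` is injective, so that it does identify `A(W)` with a
subalgebra of `A(V)`. -/
theorem cliffordIncl_injective (φ : LinearMap.BilinForm F V) (W : Submodule F V) :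
    Function.Injective (cliffordIncl φ W) := by
  have hV : LinearMap.BilinMap.toQuadraticMap (-φ) = (0 : QuadraticForm F V) - quadForm φ := by
    ext x; simp [quadForm]
  have hW : LinearMap.BilinMap.toQuadraticMap (-(φ.restrict W)) =
      (0 : QuadraticForm F W) - quadForm (φ.restrict W) := by
    ext x; simp [quadForm]
  have key : ∀ x, changeForm hV (cliffordIncl φ W x) =
      ExteriorAlgebra.map W.subtype (changeForm hW x) := by
    intro x
    induction x using CliffordAlgebra.left_induction with
    | algebraMap r => simp [changeForm_algebraMap]
    | add x y hx hy => simp only [map_add, hx, hy]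
    | ι_mul x m hx =>
      have e : cliffordIncl φ W (ι _ m) = ι (quadForm φ) (m : V) := map_apply_ι _ m
      rw [map_mul, e, changeForm_ι_mul, changeForm_ι_mul, hx, map_sub, map_mul]
      congr 1
      · congr 1
        exact (ExteriorAlgebra.map_apply_ι W.subtype m).symm
      · exact contractLeft_map (Q₁ := (0 : QuadraticForm F W)) (Q₂ := (0 : QuadraticForm F V))
          ⟨W.subtype, fun _ => rfl⟩ ((-φ) (m : V)) _
  intro x y hxy
  have h1 := key x
  rw [hxy, key y] at h1
  exact ((changeFormEquiv hW).injective (ExteriorAlgebra.map_injective_field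
    (LinearMap.ker_eq_bot.2 W.injective_subtype) h1)).symm

end Quadratic

section Lattice

variable {F V : Type*} [Field F] [AddCommGroup V] [Module F V] (O : Subring F)

/-- An integral `O`-lattice in `V`: a finitely generated `O`-submodule of `V` containing a basis
of `V`, on which the values `φ[x]` lie in `O`. -/
def IsIntegralLattice (φ : LinearMap.BilinForm F V) (N : Submodule O V) : Prop :=
  N.IsLattice F ∧ ∀ x ∈ N, quadForm φ x ∈ O

/-- An `O`-maximal lattice: a lattice that is maximal, for inclusion, among the lattices on which
the values `φ[x]` lie in `O`. -/
def IsMaximalLattice (φ : LinearMap.BilinForm F V) (L : Submodule O V) : Prop :=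
  Maximal (IsIntegralLattice O φ) L

/-- The `O`-submodule `L ∩ W` of the subspace `W`. -/
def latticeInter (L : Submodule O V) (W : Submodule F V) : Submodule O W :=
  L.comap (W.subtype.restrictScalars O)

/-- `A(N)`: the subring of the Clifford algebra `A(V)` generated by `O` and `N`. -/
noncomputable def cliffordOrder (φ : LinearMap.BilinForm F V) (N : Submodule O V) :
    Subring (CliffordAlgebra (quadForm φ)) :=
  Subring.closure
    (algebraMap F (CliffordAlgebra (quadForm φ)) '' O ∪ CliffordAlgebra.ι (quadForm φ) '' N)

/-- `A⁺(V)`: the even Clifford algebra, as a subring of `A(V)`. -/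
def evenClifford (φ : LinearMap.BilinForm F V) : Subring (CliffordAlgebra (quadForm φ)) :=
  (CliffordAlgebra.even (quadForm φ)).toSubring

/-- `A⁺(N) = A⁺(V) ∩ A(N)`. -/
noncomputable def evenCliffordOrder (φ : LinearMap.BilinForm F V) (N : Submodule O V) :
    Subring (CliffordAlgebra (quadForm φ)) :=
  evenClifford φ ⊓ cliffordOrder O φ N

end Lattice

end TernaryLattice

open TernaryLattice

namespace TernaryLattice

section

variable {F V : Type*} [Field F] [AddCommGroup V] [Module F V]

open CliffordAlgebra

/-! Write `O` for the valuation ring and `W` for the kernel of the functional `φ h`. The image of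
`L` under this functional is a finitely generated, hence principal, `O`-submodule of `F`, so `L = (L
∩ W) ⊕ O y`, and a rescaled functional `d` with kernel `W` has `d y = 1`. The Clifford relations
move `y` to the right with coefficients in `O`, so `A(L) = A(L ∩ W) + A(L ∩ W) y`
(`exists_eq_add_mul_ι`). Right contraction by `d` kills `A(W)` and sends `a + b y` to `b`. An
element `a + b y` of `A(W)` therefore has `b = 0` and equals `a`, which lies in `A(L ∩ W)`. -/

theorem cliffordIncl_ι (φ : LinearMap.BilinForm F V) (W : Submodule F V) (w : W) :
    cliffordIncl φ W (ι _ w) = ι (quadForm φ) (w : V) :=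
  map_apply_ι _ w

/-- The Clifford algebra of a subspace is killed by contraction with a functional vanishing on that
subspace. -/
theorem contractRight_cliffordIncl (φ : LinearMap.BilinForm F V) (W : Submodule F V)
    (d : Module.Dual F V) (hd : ∀ w ∈ W, d w = 0)
    (x : CliffordAlgebra (quadForm (φ.restrict W))) :
    contractRight (cliffordIncl φ W x) d = 0 := by
  induction x using CliffordAlgebra.right_induction with
  | algebraMap r => rw [AlgHom.commutes, contractRight_algebraMap]
  | add x y hx hy => rw [map_add, map_add, LinearMap.add_apply, hx, hy, add_zero]
  | mul_ι m x hx =>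
    rw [map_mul, cliffordIncl_ι, contractRight_mul_ι, hd m m.2, hx, zero_smul, zero_mul, sub_zero]

/-- Over a subring of `F` for which divisibility is total, finitely generated submodules of `F` are
principal. -/
theorem exists_eq_span_singleton_of_fg {O : Subring F}
    (htot : ∀ a b : F, (∃ c : O, a = c • b) ∨ ∃ c : O, b = c • a)
    (I : Submodule O F) (hI : I.FG) : ∃ a, I = Submodule.span O {a} := by
  induction I, hI using Submodule.fg_induction with
  | singleton x => exact ⟨x, rfl⟩
  | sup I J _ _ hI hJ =>
    obtain ⟨a, rfl⟩ := hI
    obtain ⟨b, rfl⟩ := hJ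
    rcases htot a b with ⟨c, rfl⟩ | ⟨c, rfl⟩
    · exact ⟨b, sup_eq_right.2 (Submodule.span_singleton_smul_le O c b)⟩
    · exact ⟨a, sup_eq_left.2 (Submodule.span_singleton_smul_le O c a)⟩

/-- A nonzero functional has a multiple `d` that takes values in `O` on the lattice `L` and the
value `1` at some element of `L`. -/
theorem exists_primitive_functional {O : Subring F}
    (htot : ∀ a b : F, (∃ c : O, a = c • b) ∨ ∃ c : O, b = c • a)
    (L : Submodule O V) [L.IsLattice F] (d₀ : Module.Dual F V) (hd₀ : d₀ ≠ 0) :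
    ∃ d : Module.Dual F V, ∃ y ∈ L, (∀ x, d₀ x = 0 → d x = 0) ∧ (∀ x, d x = 0 → d₀ x = 0) ∧
      d y = 1 ∧ ∀ x ∈ L, d x ∈ O := by
  obtain ⟨a, ha⟩ := exists_eq_span_singleton_of_fg htot (L.map (d₀.restrictScalars O))
    (Submodule.IsLattice.fg.map _)
  have haL : a ∈ L.map (d₀.restrictScalars O) := ha ▸ Submodule.mem_span_singleton_self a
  obtain ⟨y, hy, rfl⟩ := haL
  have hmem : ∀ x ∈ L, ∃ c : O, d₀ x = c • d₀ y := fun x hx => by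
    have h1 : d₀ x ∈ L.map (d₀.restrictScalars O) := ⟨x, hx, rfl⟩
    rw [ha] at h1
    obtain ⟨c, hc⟩ := Submodule.mem_span_singleton.1 h1
    exact ⟨c, hc.symm⟩
  -- Otherwise the generator of `d₀(L)` is zero, and `d₀` vanishes on `L`, which spans `V`.
  have hy0 : d₀ y ≠ 0 := fun h0 => hd₀ <| by
    refine LinearMap.ext_on (s := (L : Set V)) (Submodule.IsLattice.span_eq_top) fun x hx => ?_
    obtain ⟨c, hc⟩ := hmem x hx
    simp [hc, h0]
  refine ⟨(d₀ y)⁻¹ • d₀, y, hy, fun x hx => by simp [hx], fun x hx => by simpa [hy0] using hx,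
    by simp [hy0], fun x hx => ?_⟩
  obtain ⟨c, hc⟩ := hmem x hx
  have : ((d₀ y)⁻¹ • d₀) x = c := by
    simp only [LinearMap.smul_apply, hc, Subring.smul_def, smul_eq_mul]
    field_simp
  exact this ▸ c.2

/-- If `L = (L ∩ W) ⊕ O y`, then every element of `A(L)` has the form `a + b y` with `a` and `b`
in `A(L ∩ W)`. -/
theorem exists_eq_add_mul_ι {O : Subring F} (φ : LinearMap.BilinForm F V) {L : Submodule O V}
    (hL : ∀ x ∈ L, quadForm φ x ∈ O) (W : Submodule F V) {y : V} (hy : y ∈ L)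
    (hdec : ∀ x ∈ L, ∃ c : O, x - c • y ∈ W)
    {x : CliffordAlgebra (quadForm φ)} (hx : x ∈ cliffordOrder O φ L) :
    ∃ a ∈ cliffordOrder O (φ.restrict W) (latticeInter O L W),
      ∃ b ∈ cliffordOrder O (φ.restrict W) (latticeInter O L W),
        x = cliffordIncl φ W a + cliffordIncl φ W b * ι (quadForm φ) y := by
  set S := cliffordOrder O (φ.restrict W) (latticeInter O L W) with hS
  set f := cliffordIncl φ W
  set e := ι (quadForm φ) y
  have hO : ∀ c ∈ O, algebraMap F _ c ∈ S := fun c hc =>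
    Subring.subset_closure (Or.inl ⟨c, hc, rfl⟩)
  have hM : ∀ w : W, (w : V) ∈ L → ι _ w ∈ S := fun w hw =>
    Subring.subset_closure (Or.inr ⟨w, hw, rfl⟩)
  have hee : e * e = f (algebraMap F _ (quadForm φ y)) := by
    rw [AlgHom.commutes]; exact ι_sq_scalar _ _
  -- The set `S + S y` is stable under multiplication only if `y S ⊆ S + S y`; generators suffice
  -- for this.
  have hcomm : ∀ s ∈ S, ∃ a ∈ S, ∃ b ∈ S, e * f s = f a + f b * e := by
    intro s hs
    induction hs using Subring.closure_induction with
    | mem s hs =>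
      rcases hs with ⟨c, hc, rfl⟩ | ⟨w, hw, rfl⟩
      · refine ⟨0, zero_mem _, _, hO c hc, ?_⟩
        rw [AlgHom.commutes, map_zero, zero_add, Algebra.commutes]
      -- The relation `y w = 2φ(y, w) - w y` involves only the polar form, which is integral on `L`
      -- even where `φ(y, w)` is not.
      · have hp : QuadraticMap.polar (quadForm φ) y w ∈ O :=
          sub_mem (sub_mem (hL _ (add_mem hy hw)) (hL _ hy)) (hL _ hw)
        refine ⟨_, hO _ hp, _, neg_mem (hM w hw), ?_⟩
        rw [map_neg, AlgHom.commutes, cliffordIncl_ι, ← ι_mul_ι_add_swap]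
        noncomm_ring
    | zero => exact ⟨0, zero_mem _, 0, zero_mem _, by simp⟩
    | one => exact ⟨0, zero_mem _, 1, one_mem _, by simp⟩
    | add s t _ _ hs ht =>
      obtain ⟨a, ha, b, hb, h1⟩ := hs
      obtain ⟨a', ha', b', hb', h2⟩ := ht
      refine ⟨_, add_mem ha ha', _, add_mem hb hb', ?_⟩
      simp only [map_add, mul_add, add_mul, h1, h2]
      abel
    | neg s _ hs =>
      obtain ⟨a, ha, b, hb, h1⟩ := hs
      refine ⟨_, neg_mem ha, _, neg_mem hb, ?_⟩
      simp only [map_neg, mul_neg, neg_mul, h1]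
      abel
    | mul s t _ ht' hs ht =>
      obtain ⟨a, ha, b, hb, h1⟩ := hs
      obtain ⟨a', ha', b', hb', h2⟩ := ht
      refine ⟨_, add_mem (mul_mem ha ht') (mul_mem hb ha'), _, mul_mem hb hb', ?_⟩
      simp only [map_add, map_mul]
      rw [← mul_assoc, h1, add_mul, mul_assoc (f b), h2]
      noncomm_ring
  induction hx using Subring.closure_induction with
  | mem x hx =>
    rcases hx with ⟨c, hc, rfl⟩ | ⟨z, hz, rfl⟩
    · exact ⟨_, hO c hc, 0, zero_mem _, by simp⟩
    · obtain ⟨c, hc⟩ := hdec z hz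
      refine ⟨_, hM ⟨_, hc⟩ (sub_mem hz (L.smul_mem c hy)), _, hO c c.2, ?_⟩
      rw [cliffordIncl_ι, AlgHom.commutes, ← Algebra.smul_def, ← map_smul, ← map_add]
      simp [Subring.smul_def]
  | zero => exact ⟨0, zero_mem _, 0, zero_mem _, by simp⟩
  | one => exact ⟨1, one_mem _, 0, zero_mem _, by simp⟩
  | add s t _ _ hs ht =>
    obtain ⟨a, ha, b, hb, h1⟩ := hs
    obtain ⟨a', ha', b', hb', h2⟩ := ht
    refine ⟨_, add_mem ha ha', _, add_mem hb hb', ?_⟩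
    simp only [map_add, add_mul, h1, h2]
    abel
  | neg s _ hs =>
    obtain ⟨a, ha, b, hb, h1⟩ := hs
    refine ⟨_, neg_mem ha, _, neg_mem hb, ?_⟩
    simp only [map_neg, neg_mul, h1]
    abel
  | mul s t _ _ hs ht =>
    obtain ⟨a, ha, b, hb, h1⟩ := hs
    obtain ⟨a', ha', b', hb', h2⟩ := ht
    obtain ⟨p, hp, q, hq, h3⟩ := hcomm a' ha'
    obtain ⟨p', hp', q', hq', h4⟩ := hcomm b' hb'
    -- Expand `(a + b y)(a' + b' y)` with `y a' = p + q y` and `y b' = p' + q' y`; the remaining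
    -- `y²` is the scalar `φ[y]`, which lies in `O`.
    refine ⟨a * a' + b * p + b * q' * algebraMap F _ (quadForm φ y),
      add_mem (add_mem (mul_mem ha ha') (mul_mem hb hp))
        (mul_mem (mul_mem hb hq') (hO _ (hL _ hy))),
      a * b' + b * q + b * p',
      add_mem (add_mem (mul_mem ha hb') (mul_mem hb hq)) (mul_mem hb hp'), ?_⟩
    simp only [map_add, map_mul f]
    rw [← hee, h1, h2]
    calc (f a + f b * e) * (f a' + f b' * e)
        = f a * f a' + f a * f b' * e + f b * (e * f a') + f b * (e * f b') * e := by
          noncomm_ring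
      _ = _ := by
          rw [h3, h4]
          noncomm_ring

/-- `A(L) ∩ A(W) = A(L ∩ W)` when `L = (L ∩ W) ⊕ O y` and `W` is the kernel of a functional. -/
theorem mem_cliffordOrder_latticeInter {O : Subring F}
    (htot : ∀ a b : F, (∃ c : O, a = c • b) ∨ ∃ c : O, b = c • a)
    (φ : LinearMap.BilinForm F V) {L : Submodule O V} (hL : IsIntegralLattice O φ L)
    (W : Submodule F V) (d₀ : Module.Dual F V) (hd₀ : d₀ ≠ 0) (hW : ∀ x, x ∈ W ↔ d₀ x = 0)
    {w : CliffordAlgebra (quadForm (φ.restrict W))}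
    (hw : cliffordIncl φ W w ∈ cliffordOrder O φ L) :
    w ∈ cliffordOrder O (φ.restrict W) (latticeInter O L W) := by
  have := hL.1
  obtain ⟨d, y, hy, hd, hd', hdy, hdL⟩ := exists_primitive_functional htot L d₀ hd₀
  obtain ⟨a, ha, b, _, hab⟩ := exists_eq_add_mul_ι φ hL.2 W hy
    -- The coefficient of `y` in `x` is `d x`, because `d (x - d x • y) = 0`.
    (fun x hx => ⟨⟨d x, hdL x hx⟩, (hW _).2 <| hd' _ <| by simp [Subring.smul_def, hdy]⟩) hw
  have hdW : ∀ x ∈ W, d x = 0 := fun x hx => hd x ((hW x).1 hx)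
  -- Contracting `w = a + b y` by `d` leaves `0 = b`.
  have hb := congrArg (fun z => contractRight z d) hab
  simp only [map_add, LinearMap.add_apply, contractRight_mul_ι,
    contractRight_cliffordIncl φ W d hdW, hdy, one_smul, zero_mul, sub_zero, zero_add] at hb
  rw [← hb, zero_mul, add_zero] at hab
  exact cliffordIncl_injective φ W hab ▸ ha

theorem map_mem_cliffordOrder {O : Subring F} (φ : LinearMap.BilinForm F V) (L : Submodule O V)
    (W : Submodule F V) {w : CliffordAlgebra (quadForm (φ.restrict W))}
    (hw : w ∈ cliffordOrder O (φ.restrict W) (latticeInter O L W)) :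
    cliffordIncl φ W w ∈ cliffordOrder O φ L := by
  have : cliffordOrder O (φ.restrict W) (latticeInter O L W) ≤
      (cliffordOrder O φ L).comap (cliffordIncl φ W : _ →+* _) := by
    refine Subring.closure_le.2 ?_
    rintro _ (⟨c, hc, rfl⟩ | ⟨x, hx, rfl⟩)
    · exact Subring.subset_closure (Or.inl ⟨c, hc, ((cliffordIncl φ W).commutes c).symm⟩)
    · exact Subring.subset_closure (Or.inr ⟨x, hx, (cliffordIncl_ι φ W x).symm⟩)
  exact this hw

theorem map_mem_evenClifford (φ : LinearMap.BilinForm F V) (W : Submodule F V)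
    {w : CliffordAlgebra (quadForm (φ.restrict W))} (hw : w ∈ evenClifford (φ.restrict W)) :
    cliffordIncl φ W w ∈ evenClifford φ := by
  have hw' : w ∈ evenOdd (quadForm (φ.restrict W)) 0 := hw
  change cliffordIncl φ W w ∈ evenOdd (quadForm φ) 0
  induction w, hw' using even_induction with
  | algebraMap r =>
    rw [AlgHom.commutes]
    exact SetLike.algebraMap_mem_graded _ r
  | add x y hx hy ihx ihy =>
    rw [map_add]
    exact add_mem (ihx hx) (ihy hy)
  | ι_mul_ι_mul m₁ m₂ x hx ih =>
    rw [map_mul, map_mul, cliffordIncl_ι, cliffordIncl_ι]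
    have := SetLike.mul_mem_graded (ι_mul_ι_mem_evenOdd_zero (quadForm φ) m₁ m₂) (ih hx)
    rwa [zero_add] at this

end

end TernaryLattice

theorem lemma3p2 {F : Type*} [Field F] [CharZero F] [ValuativeRel F] [TopologicalSpace F]
    [IsNonarchimedeanLocalField F]
    {V : Type*} [AddCommGroup V] [Module F V] (hdim : Module.finrank F V = 4)
    (φ : LinearMap.BilinForm F V) (hsymm : φ.IsSymm) (hnondeg : φ.Nondegenerate)
    (L : Submodule 𝒪[F] V) (hL : IsMaximalLattice 𝒪[F] φ L)
    (h : V) (hh : φ h h ≠ 0) :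
    -- both sides are subrings of `A(V)`, and `A(W)` is embedded in `A(V)`, for `W = (F h)^⊥`
    (evenCliffordOrder 𝒪[F] (φ.restrict (perp φ h))
        (latticeInter 𝒪[F] L (perp φ h))).map
          (cliffordIncl φ (perp φ h) : _ →+* _) =
      evenCliffordOrder 𝒪[F] φ L ⊓
        (evenClifford (φ.restrict (perp φ h))).map
          (cliffordIncl φ (perp φ h) : _ →+* _) := by

  -- Divisibility in `F` over the valuation ring is total because values are linearly ordered.
  have htot : ∀ a b : F, (∃ c : 𝒪[F], a = c • b) ∨ ∃ c : 𝒪[F], b = c • a := by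
    have key : ∀ a b : F, ValuativeRel.valuation F a ≤ ValuativeRel.valuation F b →
        ∃ c : 𝒪[F], a = c • b := fun a b hab => by
      by_cases hb : b = 0
      · exact ⟨0, by simpa [hb] using hab⟩
      · have hb' := (Valuation.ne_zero_iff (ValuativeRel.valuation F)).2 hb
        refine ⟨⟨a / b, ?_⟩, by simp [Subring.smul_def, hb]⟩
        rw [Valuation.mem_integer_iff, map_div₀]
        exact div_le_one_of_le₀ hab zero_le
    intro a b
    exact (le_total _ _).imp (key a b) (key b a)
  have hφ : φ h ≠ 0 := fun h0 => hh (by simp [h0])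
  ext x
  constructor
  · rintro ⟨w, ⟨hw, hw'⟩, rfl⟩
    exact ⟨⟨map_mem_evenClifford φ _ hw, map_mem_cliffordOrder φ L _ hw'⟩, w, hw, rfl⟩
  · rintro ⟨⟨_, hx⟩, w, hw, rfl⟩
    -- The preimage `w` is already even, so only its integrality has to descend to `W`.
    exact ⟨w, ⟨hw, mem_cliffordOrder_latticeInter htot φ hL.prop _ (φ h) hφ
      (fun _ => mem_perp) hx⟩, rfl⟩
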